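/- Let $\mathcal G=(I,O,V)$ be a synchronous game: $I$ and $O$ are finite sets (the common inputs and the common outputs of the two players) and $V:I\times I\times O\times O\to\{0,1\}$ is a function with $V(x,x,a,b)=0$ for all $x\in I$ and all $a\neq b$ in $O$. A tuple of real numbers $\big(p(a,b|x,y)\big)_{x,y\in I,\;a,b\in O}$ is a quantum spatial (qs) correlation if there are complex Hilbert spaces $\mathcal H_A,\mathcal H_B$, orthogonal projections $E_{x,a}\in B(\mathcal H_A)$ and $F_{y,b}\in B(\mathcal H_B)$ with $\sum_{a\in O}E_{x,a}=I_{\mathcal H_A}$ for every $x\in I$ and $\sum_{b\in O}F_{y,b}=I_{\mathcal H_B}$ for every $y\in I$, and a unit vector $\psi$ in the Hilbert space tensor product $\mathcal H_A\otimes\mathcal H_B$, such that $p(a,b|x,y)=\langle (E_{x,a}\otimes F_{y,b})\psi,\psi\rangle$ for all $x,y,a,b$. It is a quantum (q) correlation if $\mathcal H_A$ and $\mathcal H_B$ can moreover be chosen finite dimensional. For $t\in\{q,qs\}$, the game $\mathcal G$ has a perfect $t$-strategy if there is a $t$-correlation $p$ such that $V(x,y,a,b)=0$ implies $p(a,b|x,y)=0$.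 Then $\mathcal G$ has a perfect qs-strategy if and only if it has a perfect q-strategy. -/

import Mathlib

open scoped TensorProduct

universe u v w z

/-- The Hilbert space tensor product: the completion of the algebraic tensor product for the inner
product determined by `⟪a ⊗ₜ b, c ⊗ₜ d⟫ = ⟪a, c⟫ * ⟪b, d⟫`. -/
abbrev HilbertTensor (H K : Type*) [NormedAddCommGroup H] [InnerProductSpace ℂ H]
    [NormedAddCommGroup K] [InnerProductSpace ℂ K] : Type _ :=
  UniformSpace.Completion (H ⊗[ℂ] K)

/-- The bounded operator `S ⊗ T` on the Hilbert space tensor product: the continuous extension of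
the algebraic tensor product of `S` and `T`. -/
noncomputable def tensorOp {H K : Type*} [NormedAddCommGroup H] [InnerProductSpace ℂ H]
    [NormedAddCommGroup K] [InnerProductSpace ℂ K] (S : H →L[ℂ] H) (T : K →L[ℂ] K) :
    HilbertTensor H K →L[ℂ] HilbertTensor H K :=
  (TensorProduct.mapL S T).completion

/-- `E x a` is, for each experiment `x`, a family of orthogonal projections, indexed by the
outcomes `a`, that sum to the identity. -/
structure IsProjectiveMeasurement {I O H : Type*} [Fintype O] [NormedAddCommGroup H]
    [InnerProductSpace ℂ H] [CompleteSpace H] (E : I → O → H →L[ℂ] H) : Prop where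
  isStarProjection : ∀ x a, IsStarProjection (E x a)
  sum_eq_one : ∀ x, ∑ a, E x a = 1

/-- `p x y a b` stands for `p(a, b | x, y)`. The correlation `p` is given by projective measurements
`E` on `H`, `F` on `K` and a unit vector `ψ` of `H ⊗ K`. (Mathlib's inner product is linear in the
second argument.) -/
structure Realizes {IA IB OA OB H K : Type*} [Fintype OA] [Fintype OB]
    [NormedAddCommGroup H] [InnerProductSpace ℂ H] [CompleteSpace H]
    [NormedAddCommGroup K] [InnerProductSpace ℂ K] [CompleteSpace K]
    (E : IA → OA → H →L[ℂ] H) (F : IB → OB → K →L[ℂ] K) (ψ : HilbertTensor H K)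
    (p : IA → IB → OA → OB → ℝ) : Prop where
  left : IsProjectiveMeasurement E
  right : IsProjectiveMeasurement F
  norm_eq_one : ‖ψ‖ = 1
  apply_eq : ∀ x y a b, (p x y a b : ℂ) = inner ℂ ψ (tensorOp (E x a) (F y b) ψ)

/-- The quantum spatial correlations `C_qs`: arbitrary Hilbert spaces. -/
def Cqs.{u', v₁, v₂, v₃, v₄} (IA : Type v₁) (IB : Type v₂) (OA : Type v₃) (OB : Type v₄)
    [Fintype OA] [Fintype OB] : Set (IA → IB → OA → OB → ℝ) :=
  {p | ∃ (H : Type u') (_ : NormedAddCommGroup H) (_ : InnerProductSpace ℂ H) (_ : CompleteSpace H)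
      (K : Type u') (_ : NormedAddCommGroup K) (_ : InnerProductSpace ℂ K) (_ : CompleteSpace K)
      (E : IA → OA → H →L[ℂ] H) (F : IB → OB → K →L[ℂ] K) (ψ : HilbertTensor H K),
      Realizes E F ψ p}

/-- The quantum correlations `C_q`: finite-dimensional Hilbert spaces. -/
def Cq.{u', v₁, v₂, v₃, v₄} (IA : Type v₁) (IB : Type v₂) (OA : Type v₃) (OB : Type v₄)
    [Fintype OA] [Fintype OB] : Set (IA → IB → OA → OB → ℝ) :=
  {p | ∃ (H : Type u') (_ : NormedAddCommGroup H) (_ : InnerProductSpace ℂ H) (_ : CompleteSpace H)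
      (K : Type u') (_ : NormedAddCommGroup K) (_ : InnerProductSpace ℂ K) (_ : CompleteSpace K)
      (E : IA → OA → H →L[ℂ] H) (F : IB → OB → K →L[ℂ] K) (ψ : HilbertTensor H K),
      FiniteDimensional ℂ H ∧ FiniteDimensional ℂ K ∧ Realizes E F ψ p}

/-- A finite input-output game with input sets `IA`, `IB` and output sets `OA`, `OB`, given by its
rule function. -/
structure Game (IA IB OA OB : Type*) [Fintype IA] [Fintype IB] [Fintype OA] [Fintype OB] where
  /-- `V x y a b = true` means that the outputs `a`, `b` win on the inputs `x`, `y`. -/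
  V : IA → IB → OA → OB → Bool

namespace Game

/-- A game with common input and output sets is synchronous if different outputs on equal inputs
lose. -/
def IsSynchronous {I O : Type*} [Fintype I] [Fintype O] (G : Game I I O O) : Prop :=
  ∀ x a b, a ≠ b → G.V x x a b = false

/-- The correlation `p` produces losing outputs with probability zero. -/
def IsPerfect {IA IB OA OB : Type*} [Fintype IA] [Fintype IB] [Fintype OA] [Fintype OB]
    (G : Game IA IB OA OB) (p : IA → IB → OA → OB → ℝ) : Prop :=
  ∀ x y a b, G.V x y a b = false → p x y a b = 0

/-- The game has a perfect quantum spatial strategy (on Hilbert spaces in the universe `u'`). -/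
def HasPerfectQsStrategy.{u', v₁, v₂, v₃, v₄} {IA : Type v₁} {IB : Type v₂} {OA : Type v₃}
    {OB : Type v₄} [Fintype IA] [Fintype IB] [Fintype OA] [Fintype OB]
    (G : Game IA IB OA OB) : Prop :=
  ∃ p ∈ Cqs.{u'} IA IB OA OB, G.IsPerfect p

/-- The game has a perfect quantum strategy (on Hilbert spaces in the universe `u'`). -/
def HasPerfectQStrategy.{u', v₁, v₂, v₃, v₄} {IA : Type v₁} {IB : Type v₂} {OA : Type v₃}
    {OB : Type v₄} [Fintype IA] [Fintype IB] [Fintype OA] [Fintype OB]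
    (G : Game IA IB OA OB) : Prop :=
  ∃ p ∈ Cq.{u'} IA IB OA OB, G.IsPerfect p

end Game

/-! Synchronicity forces `(E x a ⊗ 1)ψ = (1 ⊗ F x a)ψ`, so every `E x a` commutes with the reduced
density operator `ρ` of `ψ` (`reducedDensity_commute`). As `ρ` is compact, self-adjoint and nonzero,
it has an eigenvalue `μ ≠ 0` with a finite-dimensional eigenspace `W`, invariant under all `E x a`.
On losing outputs `(E x a * E y b ⊗ 1)ψ = (E x a ⊗ F y b)ψ = 0`, hence `E x a * E y b * ρ = 0`, and
the restrictions to `W` multiply to zero. In finite dimension, such projections `P x a`, their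
transposes and the maximally entangled vector give the perfect correlation `tr (P x a * P y b) / n`.
-/

section HilbertTensor

open UniformSpace ContinuousLinearMap

variable {H K : Type*} [NormedAddCommGroup H] [InnerProductSpace ℂ H]
  [NormedAddCommGroup K] [InnerProductSpace ℂ K]

/-- The simple tensors, as a continuous bilinear map into the Hilbert space tensor product. -/
noncomputable def hilbertTmul (H K : Type*) [NormedAddCommGroup H] [InnerProductSpace ℂ H]
    [NormedAddCommGroup K] [InnerProductSpace ℂ K] : H →L[ℂ] K →L[ℂ] HilbertTensor H K :=
  (compL ℂ K (H ⊗[ℂ] K) (HilbertTensor H K) Completion.toComplL).comp (TensorProduct.mkL ℂ H K)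

theorem hilbertTmul_apply (h : H) (k : K) :
    hilbertTmul H K h k = ((h ⊗ₜ[ℂ] k : H ⊗[ℂ] K) : HilbertTensor H K) := rfl

theorem inner_hilbertTmul (h h' : H) (k k' : K) :
    inner ℂ (hilbertTmul H K h k) (hilbertTmul H K h' k') = inner ℂ h h' * inner ℂ k k' := by
  simp only [hilbertTmul_apply, Completion.inner_coe, TensorProduct.inner_tmul]

theorem tensorOp_hilbertTmul (S : H →L[ℂ] H) (T : K →L[ℂ] K) (h : H) (k : K) :
    tensorOp S T (hilbertTmul H K h k) = hilbertTmul H K (S h) (T k) := by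
  simp only [hilbertTmul_apply, tensorOp, completion_apply_coe, TensorProduct.mapL_tmul]

/-- A closed additive property of simple tensors holds on the Hilbert space tensor product. -/
theorem HilbertTensor.induction {p : HilbertTensor H K → Prop} (hp : IsClosed {ψ | p ψ})
    (htmul : ∀ h k, p (hilbertTmul H K h k)) (hadd : ∀ ψ φ, p ψ → p φ → p (ψ + φ))
    (ψ : HilbertTensor H K) : p ψ := by
  induction ψ using Completion.induction_on with
  | hp => exact hp
  | ih t =>
    induction t with
    | zero => simpa only [map_zero, Completion.coe_zero] using htmul 0 0
    | tmul h k => exact htmul h k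
    | add x y hx hy => rw [Completion.coe_add]; exact hadd _ _ hx hy

theorem HilbertTensor.clm_ext {G : Type*} [NormedAddCommGroup G] [NormedSpace ℂ G]
    {S T : HilbertTensor H K →L[ℂ] G}
    (h : ∀ x y, S (hilbertTmul H K x y) = T (hilbertTmul H K x y)) : S = T := by
  ext ψ
  exact HilbertTensor.induction (p := fun ψ => S ψ = T ψ) (isClosed_eq S.continuous T.continuous) h
    (fun ψ φ h₁ h₂ => by rw [map_add, map_add, h₁, h₂]) ψ

theorem HilbertTensor.eq_zero_of_inner {ψ : HilbertTensor H K}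
    (hψ : ∀ h k, inner ℂ (hilbertTmul H K h k) ψ = 0) : ψ = 0 := by
  have : ∀ φ : HilbertTensor H K, inner ℂ φ ψ = 0 :=
    HilbertTensor.induction (isClosed_eq (by fun_prop) continuous_const) hψ
      (fun φ φ' h₁ h₂ => by rw [inner_add_left, h₁, h₂, add_zero])
  exact inner_self_eq_zero.mp (this ψ)

theorem tensorOp_mul (S S' : H →L[ℂ] H) (T T' : K →L[ℂ] K) :
    tensorOp (S * S') (T * T') = tensorOp S T * tensorOp S' T' :=
  HilbertTensor.clm_ext fun x y => by simp [tensorOp_hilbertTmul]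

theorem tensorOp_sum_left {ι : Type*} (s : Finset ι) (S : ι → H →L[ℂ] H) (T : K →L[ℂ] K) :
    tensorOp (∑ i ∈ s, S i) T = ∑ i ∈ s, tensorOp (S i) T :=
  HilbertTensor.clm_ext fun x y => by simp [tensorOp_hilbertTmul]

theorem tensorOp_sum_right {ι : Type*} (s : Finset ι) (S : H →L[ℂ] H) (T : ι → K →L[ℂ] K) :
    tensorOp S (∑ i ∈ s, T i) = ∑ i ∈ s, tensorOp S (T i) :=
  HilbertTensor.clm_ext fun x y => by simp [tensorOp_hilbertTmul]

variable [CompleteSpace H] [CompleteSpace K]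

set_option linter.unusedSectionVars false

theorem inner_hilbertTmul_tensorOp (S : H →L[ℂ] H) (T : K →L[ℂ] K) (h : H) (k : K)
    (ψ : HilbertTensor H K) : inner ℂ (hilbertTmul H K h k) (tensorOp S T ψ) =
      inner ℂ (hilbertTmul H K (adjoint S h) (adjoint T k)) ψ := by
  refine HilbertTensor.induction (p := fun ψ => inner ℂ (hilbertTmul H K h k) (tensorOp S T ψ) =
      inner ℂ (hilbertTmul H K (adjoint S h) (adjoint T k)) ψ)
    (isClosed_eq (by fun_prop) (by fun_prop)) (fun x y => ?_) (fun φ φ' h₁ h₂ => ?_) ψ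
  · simp only [tensorOp_hilbertTmul, inner_hilbertTmul, adjoint_inner_left]
  · rw [map_add, inner_add_right, inner_add_right, h₁, h₂]

theorem adjoint_tensorOp (S : H →L[ℂ] H) (T : K →L[ℂ] K) :
    adjoint (tensorOp S T) = tensorOp (adjoint S) (adjoint T) := by
  refine HilbertTensor.clm_ext fun x y => ext_inner_right ℂ fun ψ => ?_
  rw [adjoint_inner_left, inner_hilbertTmul_tensorOp, tensorOp_hilbertTmul]

theorem IsStarProjection.tensorOp {S : H →L[ℂ] H} {T : K →L[ℂ] K} (hS : IsStarProjection S)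
    (hT : IsStarProjection T) : IsStarProjection (tensorOp S T) where
  isIdempotentElem := by
    rw [IsIdempotentElem, ← tensorOp_mul, hS.isIdempotentElem.eq, hT.isIdempotentElem.eq]
  isSelfAdjoint := by
    rw [isSelfAdjoint_iff', adjoint_tensorOp, hS.isSelfAdjoint.adjoint_eq,
      hT.isSelfAdjoint.adjoint_eq]

/-- Since `⟪x, P x⟫ = ‖P x‖²`, an outcome of probability zero annihilates the state. -/
theorem IsStarProjection.apply_eq_zero_of_inner {P : H →L[ℂ] H} (hP : IsStarProjection P) {x : H}
    (hx : inner ℂ x (P x) = 0) : P x = 0 := by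
  have h : P (P x) = P x := congr($(hP.isIdempotentElem.eq) x)
  rw [← h, ← adjoint_inner_left, hP.isSelfAdjoint.adjoint_eq] at hx
  exact inner_self_eq_zero.mp hx

/-! ### Slices and the reduced density operator. -/

/-- The conjugate linear operator `h ↦ (⟨h| ⊗ 1) ψ`. -/
noncomputable def leftSlice : HilbertTensor H K →L[ℂ] H →L⋆[ℂ] K :=
  ((adjoint (𝕜 := ℂ) (E := K)
    (F := HilbertTensor H K)).toContinuousLinearEquiv.toContinuousLinearMap.comp (hilbertTmul H K)).flip

/-- The conjugate linear operator `k ↦ (1 ⊗ ⟨k|) ψ`. -/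
noncomputable def rightSlice : HilbertTensor H K →L[ℂ] K →L⋆[ℂ] H :=
  ((adjoint (𝕜 := ℂ) (E := H)
    (F := HilbertTensor H K)).toContinuousLinearEquiv.toContinuousLinearMap.comp (hilbertTmul H K).flip).flip

theorem inner_leftSlice (ψ : HilbertTensor H K) (h : H) (k : K) :
    inner ℂ k (leftSlice ψ h) = inner ℂ (hilbertTmul H K h k) ψ :=
  adjoint_inner_right (hilbertTmul H K h) k ψ

theorem inner_rightSlice (ψ : HilbertTensor H K) (h : H) (k : K) :
    inner ℂ h (rightSlice ψ k) = inner ℂ (hilbertTmul H K h k) ψ :=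
  adjoint_inner_right ((hilbertTmul H K).flip k) h ψ

/-- Slices of simple tensors have rank at most one, and compact operators form a closed subspace. -/
theorem isCompactOperator_leftSlice (ψ : HilbertTensor H K) :
    IsCompactOperator (leftSlice ψ) := by
  refine HilbertTensor.induction (p := fun ψ : HilbertTensor H K => IsCompactOperator (leftSlice ψ))
    ?_ (fun h₀ k₀ => ?_) (fun φ φ' h₁ h₂ => ?_) ψ
  · exact isClosed_setOfPred_isCompactOperator.preimage leftSlice.continuous
  · have h : ⇑(leftSlice (hilbertTmul H K h₀ k₀)) =
        (fun c : ℂ => c • k₀) ∘ fun h => starRingEnd ℂ (innerSL ℂ h₀ h) := by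
      ext h
      refine ext_inner_left ℂ fun k => ?_
      simp [inner_leftSlice, inner_hilbertTmul, inner_smul_right]
    rw [h]
    refine IsCompactOperator.continuous_comp (M₂ := ℂ) ?_ (by fun_prop)
    exact IsCompactOperator.continuous_comp
      (isCompactOperator_of_locallyCompactSpace_dom (innerSL ℂ h₀)) (by fun_prop)
  · rw [map_add]; exact h₁.add h₂

/-- The reduced density operator of `ψ` on the first tensor factor. -/
noncomputable def reducedDensity (ψ : HilbertTensor H K) : H →L[ℂ] H :=
  (rightSlice ψ).comp (leftSlice ψ)

theorem reducedDensity_apply (ψ : HilbertTensor H K) (h : H) :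
    reducedDensity ψ h = rightSlice ψ (leftSlice ψ h) := rfl

theorem inner_reducedDensity (ψ : HilbertTensor H K) (h h' : H) :
    inner ℂ h (reducedDensity ψ h') = inner ℂ (leftSlice ψ h') (leftSlice ψ h) := by
  rw [reducedDensity_apply, inner_rightSlice, inner_leftSlice]

theorem isCompactOperator_reducedDensity (ψ : HilbertTensor H K) :
    IsCompactOperator (reducedDensity ψ) :=
  (isCompactOperator_leftSlice ψ).continuous_comp (rightSlice ψ).continuous

theorem isSymmetric_reducedDensity (ψ : HilbertTensor H K) :
    (reducedDensity ψ).IsSymmetric := fun h h' => by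
  change inner ℂ (reducedDensity ψ h) h' = inner ℂ h (reducedDensity ψ h')
  rw [← inner_conj_symm, inner_reducedDensity, inner_reducedDensity, inner_conj_symm]

/-- Because `⟪h, ρ h⟫ = ‖leftSlice ψ h‖²`, `ρ = 0` would make `ψ` orthogonal to every simple tensor.
-/
theorem reducedDensity_ne_zero {ψ : HilbertTensor H K} (hψ : ψ ≠ 0) : reducedDensity ψ ≠ 0 := by
  refine fun h0 => hψ (HilbertTensor.eq_zero_of_inner fun h k => ?_)
  have h1 := inner_reducedDensity ψ h h
  rw [h0, zero_apply, inner_zero_right, eq_comm, inner_self_eq_zero] at h1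
  rw [← inner_leftSlice, h1, inner_zero_right]

/-- If a measurement operator on the first factor acts on `ψ` as one on the second factor does, it
commutes with the reduced density operator. -/
theorem reducedDensity_commute {ψ : HilbertTensor H K} {S : H →L[ℂ] H} {T : K →L[ℂ] K}
    (hS : IsSelfAdjoint S) (hT : IsSelfAdjoint T) (hST : tensorOp S 1 ψ = tensorOp 1 T ψ) (h : H) :
    reducedDensity ψ (S h) = S (reducedDensity ψ h) := by
  have key (h : H) (k : K) :
      inner ℂ (hilbertTmul H K (S h) k) ψ = inner ℂ (hilbertTmul H K h (T k)) ψ := by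
    have := congr(inner ℂ (hilbertTmul H K h k) $hST)
    rwa [inner_hilbertTmul_tensorOp, inner_hilbertTmul_tensorOp, hS.adjoint_eq, hT.adjoint_eq,
      ← star_eq_adjoint, ← star_eq_adjoint, star_one, star_one] at this
  -- The two slices intertwine `S` and `T` in opposite directions, so their composite commutes with
  -- `S`.
  have hl (h : H) : leftSlice ψ (S h) = T (leftSlice ψ h) := by
    refine ext_inner_left ℂ fun k => ?_
    rw [inner_leftSlice, key, ← adjoint_inner_left, hT.adjoint_eq, inner_leftSlice]
  have hr (k : K) : rightSlice ψ (T k) = S (rightSlice ψ k) := by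
    refine ext_inner_left ℂ fun h => ?_
    rw [inner_rightSlice, ← key, ← adjoint_inner_left, hS.adjoint_eq, inner_rightSlice]
  rw [reducedDensity_apply, hl, hr, reducedDensity_apply]

/-- Values of `ρ` are right slices of `ψ`, and `S` maps them to right slices of `(S ⊗ 1)ψ = 0`. -/
theorem apply_reducedDensity_eq_zero {ψ : HilbertTensor H K} {S : H →L[ℂ] H}
    (hS : tensorOp S 1 ψ = 0) (h : H) : S (reducedDensity ψ h) = 0 := by
  refine ext_inner_left ℂ fun h' => ?_
  have := congr(inner ℂ (hilbertTmul H K h' (leftSlice ψ h)) $hS)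
  rw [inner_hilbertTmul_tensorOp, ← star_eq_adjoint 1, star_one] at this
  rw [← adjoint_inner_left, reducedDensity_apply, inner_rightSlice]
  simpa using this

end HilbertTensor


/-! ### From matrix projections to a finite-dimensional strategy. -/

theorem IsStarProjection.transpose {ι : Type*} [Fintype ι] {M : Matrix ι ι ℂ}
    (hM : IsStarProjection M) : IsStarProjection M.transpose where
  isIdempotentElem := by
    rw [IsIdempotentElem, ← Matrix.transpose_mul, hM.isIdempotentElem.eq]
  isSelfAdjoint := by
    have h : M.conjTranspose = M := hM.isSelfAdjoint.star_eq
    change M.transpose.conjTranspose = M.transpose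
    nth_rw 2 [← h]
    rfl

namespace Game

/-- Projection-valued matrices that annihilate each other on losing outputs. -/
structure IsPerfectMatrixStrategy {I O ι : Type*} [Fintype I] [Fintype O] [Fintype ι]
    [DecidableEq ι] (G : Game I I O O) (P : I → O → Matrix ι ι ℂ) : Prop where
  isStarProjection : ∀ x a, IsStarProjection (P x a)
  sum_eq_one : ∀ x, ∑ a, P x a = 1
  mul_eq_zero : ∀ x y a b, G.V x y a b = false → P x a * P y b = 0

section Matrix

variable {ι : Type*} [Fintype ι] [DecidableEq ι]

/-- The unnormalized maximally entangled vector. -/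
noncomputable def diagonalVector (ι : Type*) [Fintype ι] [DecidableEq ι] :
    HilbertTensor (EuclideanSpace ℂ ι) (EuclideanSpace ℂ ι) :=
  ∑ i, hilbertTmul _ _ (EuclideanSpace.single i 1) (EuclideanSpace.single i 1)

theorem inner_diagonalVector_tensorOp (A B : Matrix ι ι ℂ) :
    inner ℂ (diagonalVector ι)
      (tensorOp (Matrix.toEuclideanCLM (𝕜 := ℂ) A) (Matrix.toEuclideanCLM (𝕜 := ℂ) B)
        (diagonalVector ι)) = (A * B.transpose).trace := by
  simp only [diagonalVector, map_sum, sum_inner, inner_sum, tensorOp_hilbertTmul,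
    inner_hilbertTmul, Matrix.trace, Matrix.diag, Matrix.mul_apply, Matrix.transpose_apply]
  rw [Finset.sum_comm]
  refine Finset.sum_congr rfl fun i _ => Finset.sum_congr rfl fun j _ => ?_
  simp [EuclideanSpace.inner_single_left]

theorem norm_diagonalVector_sq : ‖diagonalVector ι‖ ^ 2 = Fintype.card ι := by
  have h : inner ℂ (diagonalVector ι) (diagonalVector ι) = (Fintype.card ι : ℂ) := by
    simp only [diagonalVector, sum_inner, inner_sum, inner_hilbertTmul]
    simp [EuclideanSpace.inner_single_left]
  rw [← inner_self_eq_norm_sq (𝕜 := ℂ), h]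
  simp

end Matrix

theorem IsPerfectMatrixStrategy.hasPerfectQStrategy {I : Type w} {O : Type z} [Fintype I]
    [Fintype O] {ι : Type v} [Fintype ι] [DecidableEq ι] [Nonempty ι] {G : Game I I O O}
    {P : I → O → Matrix ι ι ℂ} (hP : G.IsPerfectMatrixStrategy P) :
    Game.HasPerfectQStrategy.{v} G := by
  have hn : ‖diagonalVector ι‖ ≠ 0 := fun h => by
    have := norm_diagonalVector_sq (ι := ι)
    rw [h, zero_pow two_ne_zero] at this
    exact Fintype.card_ne_zero (Nat.cast_eq_zero.mp this.symm)
  set c : ℝ := ‖diagonalVector ι‖⁻¹ with hc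
  -- Conjugation reverses the product of self-adjoint matrices, which leaves its trace unchanged.
  have hreal (x y a b) : (((P x a * P y b).trace.re : ℝ) : ℂ) = (P x a * P y b).trace := by
    rw [← Complex.conj_eq_iff_re, starRingEnd_apply, ← Matrix.trace_conjTranspose,
      Matrix.conjTranspose_mul, ← Matrix.star_eq_conjTranspose, ← Matrix.star_eq_conjTranspose,
      (hP.isStarProjection x a).isSelfAdjoint.star_eq,
      (hP.isStarProjection y b).isSelfAdjoint.star_eq, Matrix.trace_mul_comm]
  -- Here `c ^ 2` is the reciprocal of the dimension. The transpose on the second factor cancels the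
  -- one in `inner_diagonalVector_tensorOp`.
  refine ⟨fun x y a b => c ^ 2 * (P x a * P y b).trace.re, ⟨EuclideanSpace ℂ ι, inferInstance,
    inferInstance, inferInstance, EuclideanSpace ℂ ι, inferInstance, inferInstance, inferInstance,
    fun x a => Matrix.toEuclideanCLM (𝕜 := ℂ) (P x a),
    fun y b => Matrix.toEuclideanCLM (𝕜 := ℂ) (P y b).transpose,
    (c : ℂ) • diagonalVector ι, inferInstance, inferInstance, ?_⟩, ?_⟩
  · refine ⟨⟨fun x a => (hP.isStarProjection x a).map _, fun x => ?_⟩,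
      ⟨fun x a => (hP.isStarProjection x a).transpose.map _, fun x => ?_⟩, ?_, fun x y a b => ?_⟩
    · rw [← map_sum, hP.sum_eq_one, map_one]
    · rw [← map_sum, ← Matrix.transpose_sum, hP.sum_eq_one, Matrix.transpose_one, map_one]
    · rw [norm_smul, Complex.norm_real, hc, norm_inv, norm_norm, inv_mul_cancel₀ hn]
    · rw [map_smul, inner_smul_left, inner_smul_right, inner_diagonalVector_tensorOp,
        Matrix.transpose_transpose, Complex.conj_ofReal, Complex.ofReal_mul, hreal]
      push_cast
      ring
  · intro x y a b h
    simp [hP.mul_eq_zero x y a b h]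

/-! ### Compression to an eigenspace of the reduced density operator. -/

theorem HasPerfectQsStrategy.exists_isPerfectMatrixStrategy {I : Type w} {O : Type z} [Fintype I]
    [Fintype O] {G : Game I I O O} (hG : G.IsSynchronous) (h : Game.HasPerfectQsStrategy.{u} G) :
    ∃ (n : ℕ) (_ : NeZero n) (P : I → O → Matrix (ULift.{v} (Fin n)) (ULift.{v} (Fin n)) ℂ),
      G.IsPerfectMatrixStrategy P := by
  obtain ⟨p, ⟨H, _, _, _, K, _, _, _, E, F, ψ, hp⟩, hV⟩ := h
  have hE (x a) := hp.left.isStarProjection x a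
  have hF (x a) := hp.right.isStarProjection x a
  have hlose (x y a b) (hxy : G.V x y a b = false) : tensorOp (E x a) (F y b) ψ = 0 :=
    ((hE x a).tensorOp (hF y b)).apply_eq_zero_of_inner <| by
      rw [← hp.apply_eq, hV x y a b hxy, Complex.ofReal_zero]
  -- Both sides equal `(E x a ⊗ F x a)ψ`: expand `1` as the sum of the other player's projections;
  -- the unequal outputs lose.
  have hsync (x a) : tensorOp (E x a) 1 ψ = tensorOp 1 (F x a) ψ := by
    trans tensorOp (E x a) (F x a) ψ
    · rw [← hp.right.sum_eq_one x, tensorOp_sum_right, sum_apply]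
      exact Finset.sum_eq_single a (fun b _ hb => hlose x x a b (hG x a b hb.symm)) (by simp)
    · rw [← hp.left.sum_eq_one x, tensorOp_sum_left, sum_apply]
      exact (Finset.sum_eq_single a (fun b _ hb => hlose x x b a (hG x b a hb)) (by simp)).symm
  have hmul (x y a b) (hxy : G.V x y a b = false) : tensorOp (E x a * E y b) 1 ψ = 0 := by
    have h₁ : tensorOp (E x a * E y b) 1 ψ = tensorOp (E x a) 1 (tensorOp (E y b) 1 ψ) := by
      rw [← mul_apply_eq_comp, ← tensorOp_mul, one_mul]
    rw [h₁, hsync, ← mul_apply_eq_comp, ← tensorOp_mul, one_mul, mul_one,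
      hlose x y a b hxy]
  have hψ : ψ ≠ 0 := fun h => by simpa [h] using hp.norm_eq_one
  set ρ := reducedDensity ψ with hρ
  have hcpt : IsCompactOperator ρ := isCompactOperator_reducedDensity ψ
  -- A compact symmetric operator whose only possible eigenvalue is zero vanishes.
  obtain ⟨μ, hμ, hμ0⟩ : ∃ μ, Module.End.HasEigenvalue (ρ : Module.End ℂ H) μ ∧ μ ≠ 0 := by
    by_contra! hcon
    exact reducedDensity_ne_zero hψ <|
      (ContinuousLinearMap.eq_zero_of_forall_hasEigenvalue_eq_zero hcpt
        (isSymmetric_reducedDensity ψ)).mp hcon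
  set W := Module.End.eigenspace (ρ : Module.End ℂ H) μ with hW
  have hfin : FiniteDimensional ℂ W :=
    ContinuousLinearMap.finite_dimensional_eigenspace hcpt μ hμ0
  have hmem {w : H} : w ∈ W ↔ ρ w = μ • w := Module.End.mem_eigenspace_iff
  have hinv (x a) (w : H) (hw : w ∈ W) : (E x a : H →ₗ[ℂ] H) w ∈ W := by
    rw [hmem] at hw ⊢
    change ρ (E x a w) = μ • E x a w
    rw [hρ, reducedDensity_commute (hE x a).isSelfAdjoint (hF x a).isSelfAdjoint (hsync x a),
      ← hρ, hw, map_smul]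
  let R (x a) : W →ₗ[ℂ] W := (E x a : H →ₗ[ℂ] H).restrict (hinv x a)
  have hR (x a) (w : W) : (R x a w : H) = E x a w := rfl
  have hnt : Nontrivial W := Submodule.nontrivial_iff_ne_bot.mpr hμ
  -- `ULift` places the index type, hence the new Hilbert spaces, in the target universe.
  let e : OrthonormalBasis (ULift.{v} (Fin (Module.finrank ℂ W))) ℂ W :=
    (stdOrthonormalBasis ℂ W).reindex Equiv.ulift.symm
  refine ⟨Module.finrank ℂ W, ⟨Module.finrank_pos.ne'⟩,
    fun x a => LinearMap.toMatrixOrthonormal e (R x a),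
    fun x a => IsStarProjection.map ⟨?_, ?_⟩ _, fun x => ?_, fun x y a b hxy => ?_⟩
  · ext w
    exact congr($((hE x a).isIdempotentElem.eq) (w : H))
  · rw [← LinearMap.isSymmetric_iff_isSelfAdjoint]
    intro w w'
    exact (hE x a).isSelfAdjoint.isSymmetric (w : H) w'
  · rw [← map_sum, ← map_one (LinearMap.toMatrixOrthonormal e)]
    congr 1
    ext w
    simpa [hR] using congr($(hp.left.sum_eq_one x) (w : H))
  · rw [← map_mul, ← map_zero (LinearMap.toMatrixOrthonormal e)]
    congr 1
    ext w
    -- On `W`, `ρ` is multiplication by `μ ≠ 0`, which can be cancelled.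
    have h₁ := apply_reducedDensity_eq_zero (hmul x y a b hxy) w
    rw [← hρ, hmem.mp w.2, map_smul, smul_eq_zero] at h₁
    exact h₁.resolve_left hμ0

theorem HasPerfectQsStrategy.hasPerfectQStrategy {I : Type w} {O : Type z} [Fintype I]
    [Fintype O] {G : Game I I O O} (hG : G.IsSynchronous) (h : Game.HasPerfectQsStrategy.{u} G) :
    Game.HasPerfectQStrategy.{v} G := by
  obtain ⟨n, _, P, hP⟩ := h.exists_isPerfectMatrixStrategy hG
  exact hP.hasPerfectQStrategy

theorem HasPerfectQStrategy.hasPerfectQsStrategy {I : Type w} {O : Type z} [Fintype I]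
    [Fintype O] {G : Game I I O O} (h : Game.HasPerfectQStrategy.{u} G) :
    Game.HasPerfectQsStrategy.{u} G := by
  obtain ⟨p, ⟨H, _, _, _, K, _, _, _, E, F, ψ, -, -, hp⟩, hV⟩ := h
  exact ⟨p, ⟨H, _, _, inferInstance, K, _, _, inferInstance, E, F, ψ, hp⟩, hV⟩

end Game

theorem mainTheorem11 {I : Type w} {O : Type z} [Fintype I] [Fintype O]
    (G : Game I I O O) (hG : G.IsSynchronous) :
    Game.HasPerfectQsStrategy.{u} G ↔ Game.HasPerfectQStrategy.{v} G := by
  -- The converse passes through the matrix construction again to move from universe `v` to `u`.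
  exact ⟨fun h => h.hasPerfectQStrategy hG,
    fun h => (h.hasPerfectQsStrategy.hasPerfectQStrategy hG).hasPerfectQsStrategy⟩
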